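/- Let $x_1,\dots,x_N$ be design points, $f(x;\theta)$ a real-valued regression function with parameter $\theta\in\mathbb R^p$, $\Theta\subseteq\mathbb R^p$ a parameter space, $\beta$ an interior point of $\Theta$, $\Psi=(\psi_1,\dots,\psi_N)^T\in\mathbb R^N$ and $\sigma^2>0$. For each $n$, $n_i=n_i(n)$ observations $$Y_{ij}=f(x_i;\beta)+n^{-1/2}\psi_i+\varepsilon_{ij},\qquad 1\le i\le N,\ 1\le j\le n_i,\qquad \sum_{i=1}^N n_i=n,$$ are planned, with independent errors $\varepsilon_{ij}\sim N(0,\sigma^2)$. The response $Y_{ij}$ is observed if $m_{ij}=1$ and missing if $m_{ij}=0$; the vector $\mathbf M=(m_{ij})$ of missing indicators is random and independent of the errors. Assume that each $f(x_i;\cdot)$ is Borel measurable and twice continuously differentiable near $\beta$. Put $z_i=\partial f(x_i;\theta)/\partial\theta|_{\theta=\beta}$, let $Z$ be the $N\times p$ matrix with rows $z_1^T,\dots,z_N^T$, and let $D_{\xi M}$ be the diagonal matrix with entries $\sum_{j}m_{ij}$, $i=1,\dots,N$. Assume that there is a set $S\subseteq\{1,\dots,N\}$ such that (a) for every $i\in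 S$ the number $\sum_j m_{ij}$ of responses observed at $x_i$ is of exact order $n$ in probability: for every $\epsilon>0$ there are $0<c\le C<\infty$ with $P(cn\le\sum_j m_{ij}\le Cn)\ge 1-\epsilon$ for all large $n$; (b) the submatrix of $Z$ formed by the rows $z_i^T$, $i\in S$, has linearly independent columns; (c) $\beta$ is identified by the points in $S$: for every $\delta>0$ there is $\kappa>0$ such that $\max_{i\in S}|f(x_i;\theta)-f(x_i;\beta)|\ge\kappa$ for all $\theta\in\Theta$ with $\|\theta-\beta\|\ge\delta$. Let $\hat\beta=\hat\beta_n$ be random vectors which, with probability tending to one, are complete-case maximum likelihood estimates for the fitted model $y=f(x;\theta)+\varepsilon$, $\varepsilon\sim N(0,\sigma^2)$, that is, $\hat\beta_n$ maximizes over $\theta\in\Theta$ the product of the $N(f(x_i;\theta),\sigma^2)$ densities at those $Y_{ij}$ with $m_{ij}=1$. Then, as $n\to\infty$, the matrix $Z^TD_{\xi M}Z$ is invertible with probability tending to one, and for every $i\in\{1,\dots,N\}$, conditionally on the missing indicators $\mathbf M$, $\sqrt n\,(f(x_i;\hat\beta)-f(x_i;\beta))$ is asymptotically normal with asymptotic mean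 $$z_i^T(Z^TD_{\xi M}Z)^{-1}Z^TD_{\xi M}\Psi$$ and asymptotic variance $$n\sigma^2\,z_i^T(Z^TD_{\xi M}Z)^{-1}z_i .$$ That is, the Lévy–Prokhorov distance between the conditional law of $\sqrt n\,(f(x_i;\hat\beta)-f(x_i;\beta))$ given $\mathbf M$ and the normal law with this mean and this variance converges to $0$ in probability. -/

import Mathlib

open MeasureTheory ProbabilityTheory Filter Topology
open scoped NNReal ENNReal Matrix

noncomputable section

namespace MissingDesign

/-- A missingness pattern for a design with `cnt i` observations at the `i`-th design point:
`m i j = true` means that the `j`-th response at the `i`-th point is observed (`m_{ij} = 1`),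
`m i j = false` that it is missing (`m_{ij} = 0`). -/
abbrev Pattern {N : ℕ} (cnt : Fin N → ℕ) : Type :=
  (i : Fin N) → Fin (cnt i) → Bool

/-- An array of real numbers (responses or errors), `cnt i` of them at the `i`-th point. -/
abbrev RealArray {N : ℕ} (cnt : Fin N → ℕ) : Type :=
  (i : Fin N) → Fin (cnt i) → ℝ

/-- The number `∑_j m_{ij}` of observed responses at the `i`-th design point. -/
def observedCount {N : ℕ} {cnt : Fin N → ℕ} (m : Pattern cnt) (i : Fin N) : ℕ :=
  ∑ j, if m i j = true then 1 else 0

/-- The diagonal matrix `D_{ξM}` of the numbers of observed responses. -/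
def matD {N : ℕ} {cnt : Fin N → ℕ} (m : Pattern cnt) : Matrix (Fin N) (Fin N) ℝ :=
  Matrix.diagonal fun i => (observedCount m i : ℝ)

/-- The `N × p` matrix `Z(β)`: its `i`-th row is the gradient `z_i(β)` of
`θ ↦ f(x_i; θ)` at `β`, written with partial derivatives. -/
def matZ {X : Type*} {N p : ℕ} (f : X → EuclideanSpace ℝ (Fin p) → ℝ) (x : Fin N → X)
    (β : EuclideanSpace ℝ (Fin p)) : Matrix (Fin N) (Fin p) ℝ :=
  Matrix.of fun i k => fderiv ℝ (f (x i)) β (EuclideanSpace.single k 1)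

/-- The matrix `Zᵀ(β) D_{ξM} Z(β)`. -/
def infoMatrix {X : Type*} {N p : ℕ} {cnt : Fin N → ℕ}
    (f : X → EuclideanSpace ℝ (Fin p) → ℝ) (x : Fin N → X)
    (β : EuclideanSpace ℝ (Fin p)) (m : Pattern cnt) : Matrix (Fin p) (Fin p) ℝ :=
  (matZ f x β)ᵀ * matD m * matZ f x β

/-- The asymptotic mean `z_iᵀ (Zᵀ D_{ξM} Z)⁻¹ Zᵀ D_{ξM} Ψ`. -/
def asympMean {X : Type*} {N p : ℕ} {cnt : Fin N → ℕ}
    (f : X → EuclideanSpace ℝ (Fin p) → ℝ) (x : Fin N → X)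
    (β : EuclideanSpace ℝ (Fin p)) (Ψ : Fin N → ℝ) (m : Pattern cnt) (i : Fin N) : ℝ :=
  matZ f x β i ⬝ᵥ (((infoMatrix f x β m)⁻¹ * (matZ f x β)ᵀ * matD m) *ᵥ Ψ)

/-- The asymptotic variance `n σ² z_iᵀ (Zᵀ D_{ξM} Z)⁻¹ z_i`; here `v = σ²`. -/
def asympVar {X : Type*} {N p : ℕ} {cnt : Fin N → ℕ}
    (f : X → EuclideanSpace ℝ (Fin p) → ℝ) (x : Fin N → X)
    (β : EuclideanSpace ℝ (Fin p)) (v : ℝ≥0) (n : ℕ) (m : Pattern cnt) (i : Fin N) : ℝ :=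
  n * v * (matZ f x β i ⬝ᵥ ((infoMatrix f x β m)⁻¹ *ᵥ matZ f x β i))

/-- The complete-case likelihood of the fitted model `y = f(x; θ) + ε`, `ε ~ N(0, v)`:
the product of the normal densities of the responses that are not missing. -/
def completeCaseLikelihood {X : Type*} {N p : ℕ} {cnt : Fin N → ℕ}
    (f : X → EuclideanSpace ℝ (Fin p) → ℝ) (x : Fin N → X) (v : ℝ≥0)
    (m : Pattern cnt) (y : RealArray cnt) (θ : EuclideanSpace ℝ (Fin p)) : ℝ :=
  ∏ i, ∏ j, if m i j = true then gaussianPDFReal (f (x i) θ) v (y i j) else 1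

/-- `b` is a complete-case maximum likelihood estimate over the parameter space `Θ`
(for the normal model the maximizers in `θ` are the same for every value `v > 0`). -/
def IsCompleteCaseMLE {X : Type*} {N p : ℕ} {cnt : Fin N → ℕ}
    (f : X → EuclideanSpace ℝ (Fin p) → ℝ) (x : Fin N → X)
    (Θ : Set (EuclideanSpace ℝ (Fin p))) (v : ℝ≥0)
    (m : Pattern cnt) (y : RealArray cnt) (b : EuclideanSpace ℝ (Fin p)) : Prop :=
  b ∈ Θ ∧ ∀ θ ∈ Θ,
    completeCaseLikelihood f x v m y θ ≤ completeCaseLikelihood f x v m y b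

/-- The responses under the exact model `Y_{ij} = f(x_i; β) + n^{-1/2} ψ_i + ε_{ij}`. -/
def response {X : Type*} {N p : ℕ} {cnt : Fin N → ℕ}
    (f : X → EuclideanSpace ℝ (Fin p) → ℝ) (x : Fin N → X)
    (β : EuclideanSpace ℝ (Fin p)) (Ψ : Fin N → ℝ) (n : ℕ) (e : RealArray cnt) :
    RealArray cnt :=
  fun i j => f (x i) β + Ψ i / √(n : ℝ) + e i j

/-- The random variables `A n` are of exact order `a n` in probability: for every `ε > 0`
there are `0 < c` and `C` with `c * a n ≤ A n ≤ C * a n` outside an event of probability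
at most `ε`, for all large `n`. -/
def IsExactOrderInProb {Ω : Type*} [MeasurableSpace Ω] (P : Measure Ω)
    (A : ℕ → Ω → ℝ) (a : ℕ → ℝ) : Prop :=
  ∀ ε : ℝ≥0∞, 0 < ε → ∃ c C : ℝ, 0 < c ∧ ∀ᶠ n in atTop,
    P {ω | ¬ (c * a n ≤ A n ω ∧ A n ω ≤ C * a n)} ≤ ε

/-- `β` is identified, within `Θ`, by the mean responses at the design points in `S`:
these stay away from their values at `β` when `θ` stays away from `β`. -/
def IsIdentified {X : Type*} {N p : ℕ}
    (f : X → EuclideanSpace ℝ (Fin p) → ℝ) (x : Fin N → X)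
    (Θ : Set (EuclideanSpace ℝ (Fin p))) (S : Finset (Fin N))
    (β : EuclideanSpace ℝ (Fin p)) : Prop :=
  ∀ δ : ℝ, 0 < δ → ∃ κ : ℝ, 0 < κ ∧ ∀ θ ∈ Θ, δ ≤ dist θ β →
    ∃ i ∈ S, κ ≤ |f (x i) θ - f (x i) β|

/-- The conditional law of the real random variable `T` given the event `M = m`. -/
def condLaw {Ω α : Type*} [MeasurableSpace Ω] (P : Measure Ω) (M : Ω → α) (T : Ω → ℝ)
    (m : α) : Measure ℝ :=
  (P[|M ⁻¹' {m}]).map T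

end MissingDesign

end

/-!
With `w i` the share of the `n` planned observations that is observed at the `i`-th design point,
and `G i θ = √n (f (x i) θ - f (x i) β)`, the complete-case maximum likelihood estimate minimizes
`∑ i, (w i * G i θ ^ 2 - 2 * U i * G i θ)` over `Θ`. Here `U i = w i ψ_i + W i / √n`, and `W i` is
the sum of the errors of the observed responses at the `i`-th point. Conditionally on the missing
indicators `W i` is normal with variance `σ²` times the number of its terms, so that `U i` is of
the order of `√(w i)` in probability (`measure_exists_lt_abs_observedSum_le`,
`abs_dataVector_le`). This bound is what keeps points with few observed responses harmless.

The analytic part, `eventually_abs_minimizer_sub_le`, is deterministic. The value of the criterion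
at the estimate `b` is at most its value `0` at `β`, which bounds `√(w i) |G i b|`. On `S` the
weights stay away from zero, and identification followed by the full rank of the gradients shows
that `√n (b - β)` stays bounded. Comparing the criterion at `b` with its value at `β + s / √n`,
where `s` solves the normal equations of the linearized problem, and completing the square, one
finds that `G i b` differs from `z_iᵀ s` by a quantity that tends to zero, uniformly in the
weights and the data. For the maximum likelihood estimate `z_iᵀ s` is the asymptotic mean plus a
linear combination of the observed errors (`exists_normalEquations`), and for a fixed pattern of
missing responses its law is exactly the asserted normal law (`hasLaw_normalApprox`).

The passage to conditional laws rests on two facts: two random variables that differ by at least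
`ε` with probability at most `ε` have laws at Lévy–Prokhorov distance at most `ε`
(`levyProkhorovDist_map_le`), and the conditional probability, given the missing indicators, of an
event of small probability is small in probability, by Markov's inequality
(`measure_le_cond_fiber_le`).
-/

/-! ### Gaussian linear combinations, conditioning and the Lévy–Prokhorov distance -/

namespace MissingDesign

section Probability

variable {Ω : Type*} [MeasurableSpace Ω] {P : Measure Ω}

/-- A linear combination of independent centred normal variables with common variance is
centred normal. -/
lemma hasLaw_sum_mul_gaussianReal [IsProbabilityMeasure P] {ι : Type*} [Fintype ι]
    {e : ι → Ω → ℝ} {v : ℝ≥0} (he : ∀ k, HasLaw (e k) (gaussianReal 0 v) P)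
    (hind : iIndepFun e P) (a : ι → ℝ) :
    HasLaw (fun ω => ∑ k, a k * e k ω) (gaussianReal 0 ((∑ k, a k ^ 2) * v).toNNReal) P := by
  have hae : ∀ k, AEMeasurable (fun ω => a k * e k ω) P :=
    fun k => (he k).aemeasurable.const_mul _
  have hmeas : AEMeasurable (fun ω => ∑ k, a k * e k ω) P :=
    Finset.aemeasurable_fun_sum _ fun k _ => hae k
  refine ⟨hmeas, ?_⟩
  have hind' : iIndepFun (fun k ω => a k * e k ω) P :=
    hind.comp (fun k y => a k * y) (fun k => measurable_const_mul _)
  have := Measure.isProbabilityMeasure_map (μ := P) hmeas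
  refine Measure.ext_of_charFun ?_
  rw [hind'.charFun_map_fun_sum_eq_prod hae]
  ext t
  rw [Finset.prod_apply]
  have h1 : ∀ k, charFun (P.map (fun ω => a k * e k ω)) t
      = Complex.exp (-((a k ^ 2 * v * t ^ 2 / 2 : ℝ) : ℂ)) := fun k => by
    rw [(gaussianReal_const_mul (he k) (a k)).map_eq, charFun_gaussianReal]
    congr 1
    simp
  simp_rw [h1]
  rw [← Complex.exp_sum, charFun_gaussianReal]
  congr 1
  have h0 : 0 ≤ (∑ k, a k ^ 2) * (v : ℝ) := by positivity
  rw [Real.coe_toNNReal _ h0]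
  simp only [Finset.sum_mul, Finset.sum_div, Complex.ofReal_mul, Complex.ofReal_sum,
    Complex.ofReal_zero, mul_zero, zero_mul, zero_sub, Finset.sum_neg_distrib]
  push_cast
  rfl

/-- If two random variables differ by at least `ε` with probability at most `ε`, then the
Lévy–Prokhorov distance of their laws is at most `ε`. -/
lemma levyProkhorovDist_map_le [IsProbabilityMeasure P] {T L : Ω → ℝ} (hT : AEMeasurable T P)
    (hL : AEMeasurable L P) {ε : ℝ} (hε : 0 ≤ ε)
    (h : P {ω | ε ≤ |T ω - L ω|} ≤ ENNReal.ofReal ε) :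
    levyProkhorovDist (P.map T) (P.map L) ≤ ε := by
  have := Measure.isProbabilityMeasure_map (μ := P) hT
  have := Measure.isProbabilityMeasure_map (μ := P) hL
  refine levyProkhorovDist_le_of_forall_le _ _ hε fun δ B hδ hB => ?_
  rw [Measure.map_apply_of_aemeasurable hT hB,
    Measure.map_apply_of_aemeasurable hL Metric.isOpen_thickening.measurableSet]
  have hsub : T ⁻¹' B ⊆ L ⁻¹' Metric.thickening δ B ∪ {ω | ε ≤ |T ω - L ω|} := by
    intro ω hω
    by_cases h' : ε ≤ |T ω - L ω|
    · exact Or.inr h'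
    · refine Or.inl (Metric.mem_thickening_iff.2 ⟨T ω, hω, ?_⟩)
      rw [dist_comm, Real.dist_eq]
      linarith [not_le.1 h']
  calc P (T ⁻¹' B) ≤ _ := measure_mono hsub
    _ ≤ _ := measure_union_le _ _
    _ ≤ _ := by
      gcongr
      exact h.trans (ENNReal.ofReal_le_ofReal hδ.le)

variable {α : Type*} [MeasurableSpace α] [MeasurableSingletonClass α] {M : Ω → α}

/-- Conditioning on a value of an independent variable does not change a law. -/
lemma hasLaw_cond_of_indepFun [IsFiniteMeasure P] {β : Type*} [MeasurableSpace β]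
    {Y : Ω → β} {ν : Measure β}
    (hM : Measurable M) (hY : HasLaw Y ν P) (hind : IndepFun M Y P) {m : α}
    (hm : P (M ⁻¹' {m}) ≠ 0) : HasLaw Y ν (P[|M ⁻¹' {m}]) := by
  have hac : AEMeasurable Y (P[|M ⁻¹' {m}]) :=
    hY.aemeasurable.mono_ac cond_absolutelyContinuous
  refine ⟨hac, ?_⟩
  ext B hB
  rw [Measure.map_apply_of_aemeasurable hac hB, cond_apply (hM (measurableSet_singleton m)),
    hind.measure_inter_preimage_eq_mul _ _ (measurableSet_singleton m) hB, ← mul_assoc,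
    ENNReal.inv_mul_cancel hm (measure_ne_top _ _), one_mul, ← hY.map_eq,
    Measure.map_apply_of_aemeasurable hY.aemeasurable hB]

variable [Fintype α]

/-- Markov's inequality for the conditional probability of an event given `M`. The event need
not be measurable, `P` being used as an outer measure. -/
lemma measure_le_cond_fiber_le (hM : Measurable M) (A : Set Ω) {δ : ℝ≥0∞} (hδ : δ ≠ 0)
    (hδ' : δ ≠ ∞) : P {ω | δ < P[A | M ⁻¹' {M ω}]} ≤ P A / δ := by
  classical
  have hms : ∀ m, MeasurableSet (M ⁻¹' {m}) := fun m => hM (measurableSet_singleton m)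
  set E : Finset α := Finset.univ.filter fun m => δ < P[A | M ⁻¹' {m}] with hE
  have hset : {ω | δ < P[A | M ⁻¹' {M ω}]} = M ⁻¹' (E : Set α) := by
    ext ω; simp [hE]
  rw [hset, ENNReal.le_div_iff_mul_le (Or.inl hδ) (Or.inl hδ'),
    ← sum_measure_preimage_singleton _ fun m _ => hms m, Finset.sum_mul]
  calc ∑ m ∈ E, P (M ⁻¹' {m}) * δ ≤ ∑ m ∈ E, (P.restrict A) (M ⁻¹' {m}) := by
        refine Finset.sum_le_sum fun m hm => ?_
        have hlt : δ < P[A | M ⁻¹' {m}] := by simpa [hE] using hm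
        rw [Measure.restrict_apply (hms m)]
        calc P (M ⁻¹' {m}) * δ ≤ P (M ⁻¹' {m}) * P[A | M ⁻¹' {m}] := by gcongr
          _ ≤ P (M ⁻¹' {m} ∩ A) := by
            rw [cond_apply (hms m), ← mul_assoc]
            exact mul_le_of_le_one_left zero_le (ENNReal.mul_inv_le_one _)
    _ = (P.restrict A) (M ⁻¹' (E : Set α)) := sum_measure_preimage_singleton _ fun m _ => hms m
    _ ≤ (P.restrict A) Set.univ := measure_mono (Set.subset_univ _)
    _ = P A := by simp

variable [IsProbabilityMeasure P]

/-- Law of total probability, as an upper bound for sets that depend on the value of `M`. -/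
lemma measure_le_of_forall_fiber_le (hM : Measurable M) (F : α → Set Ω) {q : ℝ≥0∞}
    (h : ∀ m, P (M ⁻¹' {m} ∩ F m) ≤ P (M ⁻¹' {m}) * q) : P {ω | ω ∈ F (M ω)} ≤ q := by
  have hsub : {ω | ω ∈ F (M ω)} ⊆ ⋃ m ∈ (Finset.univ : Finset α), M ⁻¹' {m} ∩ F m := by
    intro ω hω
    simp only [Set.mem_iUnion]
    exact ⟨M ω, Finset.mem_univ _, rfl, hω⟩
  calc P {ω | ω ∈ F (M ω)} ≤ _ := measure_mono hsub
    _ ≤ ∑ m, P (M ⁻¹' {m} ∩ F m) := measure_biUnion_finset_le _ _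
    _ ≤ ∑ m, P (M ⁻¹' {m}) * q := Finset.sum_le_sum fun m _ => h m
    _ = P (M ⁻¹' (Finset.univ : Finset α)) * q := by
      rw [← Finset.sum_mul,
        sum_measure_preimage_singleton _ fun m _ => hM (measurableSet_singleton m)]
    _ = q := by simp

/-- Almost surely `M` takes a value of positive probability. -/
lemma measure_fiber_eq_zero (hM : Measurable M) : P {ω | P (M ⁻¹' {M ω}) = 0} = 0 := by
  refine le_antisymm ?_ zero_le
  refine measure_le_of_forall_fiber_le hM (fun m => {_ω | P (M ⁻¹' {m}) = 0}) fun m => ?_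
  by_cases hm : P (M ⁻¹' {m}) = 0
  · exact (measure_mono Set.inter_subset_left).trans (by simp [hm])
  · simp [hm]

end Probability

end MissingDesign

/-! ### Minimizers of the weighted least squares criterion -/

namespace MissingDesign

section LeastSquares

variable {ι : Type*} [Fintype ι]

/-- The weighted least squares criterion `∑ (w G² - 2 U G)`, up to an additive constant. -/
noncomputable def wlsCriterion (w U G : ι → ℝ) : ℝ :=
  ∑ i, (w i * G i ^ 2 - 2 * U i * G i)

/-- The set where the criterion is not positive is bounded in the seminorm given by the weights.
The bound does not depend on the weights, although these may be arbitrarily small. -/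
lemma sqrt_mul_abs_le_of_wlsCriterion_nonpos {w U G : ι → ℝ} {K : ℝ} (hw : ∀ i, 0 ≤ w i)
    (hK : 0 ≤ K) (hU : ∀ i, |U i| ≤ K * √(w i)) (h : wlsCriterion w U G ≤ 0) (i : ι) :
    √(w i) * |G i| ≤ K * (1 + Fintype.card ι) := by
  have h1 : ∀ j, (√(w j) * |G j| - K) ^ 2 - K ^ 2 ≤ w j * G j ^ 2 - 2 * U j * G j := by
    intro j
    have e1 : (√(w j) * |G j|) ^ 2 = w j * G j ^ 2 := by
      rw [mul_pow, Real.sq_sqrt (hw j), sq_abs]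
    have e2 : U j * G j ≤ K * √(w j) * |G j| :=
      (le_abs_self _).trans (by rw [abs_mul]; gcongr; exact hU j)
    nlinarith
  have h2 : ∑ j, ((√(w j) * |G j| - K) ^ 2 - K ^ 2) ≤ 0 :=
    (Finset.sum_le_sum fun j _ => h1 j).trans h
  rw [Finset.sum_sub_distrib, Finset.sum_const, Finset.card_univ, nsmul_eq_mul] at h2
  have h3 : (√(w i) * |G i| - K) ^ 2 ≤ ∑ j, (√(w j) * |G j| - K) ^ 2 :=
    Finset.single_le_sum (f := fun j => (√(w j) * |G j| - K) ^ 2)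
      (fun j _ => sq_nonneg _) (Finset.mem_univ i)
  have hc : (1 : ℝ) ≤ Fintype.card ι := by
    exact_mod_cast Fintype.card_pos_iff.2 ⟨i⟩
  have h4 : (√(w i) * |G i| - K) ^ 2 ≤ (K * Fintype.card ι) ^ 2 := by
    nlinarith [mul_nonneg (sq_nonneg K) (sub_nonneg.2 hc),
      mul_nonneg (mul_nonneg (sq_nonneg K) (sub_nonneg.2 hc)) (by linarith : (0:ℝ) ≤ Fintype.card ι)]
  have h5 := abs_le_of_sq_le_sq h4 (by positivity)
  linarith [(abs_le.1 h5).2]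

/-- The criterion changes little when its argument does. -/
lemma abs_wlsCriterion_sub_le {w U a b : ι → ℝ} {K A η : ℝ} (hw : ∀ i, 0 ≤ w i)
    (hw1 : ∀ i, w i ≤ 1) (hU : ∀ i, |U i| ≤ K) (ha : ∀ i, |a i| ≤ A)
    (hab : ∀ i, |b i - a i| ≤ η) :
    |wlsCriterion w U b - wlsCriterion w U a|
      ≤ Fintype.card ι * (η * (2 * A + η + 2 * K)) := by
  unfold wlsCriterion
  rw [← Finset.sum_sub_distrib]
  refine (Finset.abs_sum_le_sum_abs _ _).trans ?_
  rw [← nsmul_eq_mul]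
  refine Finset.sum_le_card_nsmul _ _ _ fun i _ => ?_
  have e : w i * b i ^ 2 - 2 * U i * b i - (w i * a i ^ 2 - 2 * U i * a i)
      = (b i - a i) * (w i * (2 * a i + (b i - a i)) - 2 * U i) := by ring
  rw [e, abs_mul]
  have h1 : |w i * (2 * a i + (b i - a i)) - 2 * U i| ≤ 2 * A + η + 2 * K := by
    have h2 : |2 * a i + (b i - a i)| ≤ 2 * A + η := by
      refine (abs_add_le _ _).trans ?_
      rw [abs_mul, abs_two]
      linarith [ha i, hab i]
    have h3 : |w i * (2 * a i + (b i - a i))| ≤ 2 * A + η := by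
      rw [abs_mul, abs_of_nonneg (hw i)]
      exact (mul_le_of_le_one_left (abs_nonneg _) (hw1 i)).trans h2
    refine (abs_sub _ _).trans ?_
    rw [abs_mul 2, abs_two]
    linarith [hU i]
  exact mul_le_mul (hab i) h1 (abs_nonneg _) ((abs_nonneg _).trans (hab i))

/-- Completing the square at a solution of the normal equations. -/
lemma wlsCriterion_sub_eq {w U a d : ι → ℝ}
    (hs : ∑ i, w i * a i * d i = ∑ i, U i * d i) :
    wlsCriterion w U (fun i => a i + d i) - wlsCriterion w U a = ∑ i, w i * d i ^ 2 := by
  unfold wlsCriterion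
  rw [← Finset.sum_sub_distrib]
  have : ∀ i, w i * (a i + d i) ^ 2 - 2 * U i * (a i + d i) - (w i * a i ^ 2 - 2 * U i * a i)
      = w i * d i ^ 2 + 2 * (w i * a i * d i) - 2 * (U i * d i) := fun i => by ring
  simp_rw [this]
  rw [Finset.sum_sub_distrib, Finset.sum_add_distrib, ← Finset.mul_sum, ← Finset.mul_sum, hs]
  ring

variable {E : Type*} [NormedAddCommGroup E] [NormedSpace ℝ E]

/-- Finitely many linear forms that separate points of a finite-dimensional space
bound the norm from above. -/
lemma exists_pos_mul_norm_le [FiniteDimensional ℝ E] {κ : Type*} (z : κ → E →L[ℝ] ℝ)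
    (S : Finset κ)
    (hinj : ∀ u, (∀ i ∈ S, z i u = 0) → u = 0) :
    ∃ l > 0, ∀ u B, 0 ≤ B → (∀ i ∈ S, |z i u| ≤ B) → l * ‖u‖ ≤ B := by
  let F : E →ₗ[ℝ] (S → ℝ) := LinearMap.pi fun i => (z i : E →ₗ[ℝ] ℝ)
  obtain ⟨K, hK, hF⟩ := F.exists_antilipschitzWith (by
    rw [LinearMap.ker_eq_bot']
    intro u hu
    exact hinj u fun i hi => congrFun hu ⟨i, hi⟩)
  refine ⟨(K : ℝ)⁻¹, by positivity, fun u B hB h => ?_⟩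
  have h1 : ‖u‖ ≤ K * ‖F u‖ := by simpa using hF.le_mul_dist u 0
  have h2 : ‖F u‖ ≤ B := (pi_norm_le_iff_of_nonneg hB).2 fun i => h i i.2
  rw [inv_mul_le_iff₀ (by exact_mod_cast hK)]
  exact h1.trans (by gcongr)

/-- The weighted quadratic form is positive definite, uniformly over all weights that are at least
`c` on `S`. -/
lemma mul_norm_sq_le_sum {z : ι → E →L[ℝ] ℝ} {S : Finset ι} {l c : ℝ} (hl : 0 < l) (hc : 0 < c)
    (hz : ∀ u B, 0 ≤ B → (∀ i ∈ S, |z i u| ≤ B) → l * ‖u‖ ≤ B) {w : ι → ℝ}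
    (hw : ∀ i, 0 ≤ w i) (hcw : ∀ i ∈ S, c ≤ w i) (u : E) :
    c * l ^ 2 * ‖u‖ ^ 2 ≤ ∑ i, w i * z i u ^ 2 := by
  set X := ∑ i, w i * z i u ^ 2 with hX
  have hX0 : 0 ≤ X := Finset.sum_nonneg fun i _ => mul_nonneg (hw i) (sq_nonneg _)
  have h1 : l * ‖u‖ ≤ √(X / c) := by
    refine hz u _ (Real.sqrt_nonneg _) fun i hi => Real.abs_le_sqrt ?_
    rw [le_div_iff₀ hc]
    calc z i u ^ 2 * c ≤ z i u ^ 2 * w i := by gcongr; exact hcw i hi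
      _ = w i * z i u ^ 2 := mul_comm _ _
      _ ≤ X := Finset.single_le_sum (f := fun i => w i * z i u ^ 2)
          (fun j _ => mul_nonneg (hw j) (sq_nonneg _)) (Finset.mem_univ i)
  have h2 : (l * ‖u‖) ^ 2 ≤ X / c := by
    rw [← Real.sq_sqrt (div_nonneg hX0 hc.le)]
    gcongr
  rw [le_div_iff₀ hc] at h2
  linarith [h2, mul_pow l ‖u‖ 2]

/-- **Linearization of the least squares estimate.** Up to an error that is uniform in the weights
and in the data vector `U`, a minimizer `b` of the criterion over `Θ` behaves as if the regression
function were linear: `√n (g i b - g i β)` is close to `z i s`, where `s` solves the normal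
equations of the linearized problem. The criterion at `b` is compared with the criterion at
`β + s / √n`; no estimating equation is differentiated, so that differentiability of `g` at the
point `β` suffices. -/
theorem eventually_abs_minimizer_sub_le [FiniteDimensional ℝ E] {g : ι → E → ℝ}
    {z : ι → E →L[ℝ] ℝ} {β : E} (hz : ∀ i, HasFDerivAt (g i) (z i) β) {Θ : Set E}
    (hβ : β ∈ interior Θ) {S : Finset ι} (hinj : ∀ u, (∀ i ∈ S, z i u = 0) → u = 0)
    (hid : ∀ δ : ℝ, 0 < δ → ∃ κ : ℝ, 0 < κ ∧ ∀ θ ∈ Θ, δ ≤ dist θ β →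
      ∃ i ∈ S, κ ≤ |g i θ - g i β|)
    {c K ε : ℝ} (hc : 0 < c) (hK : 0 ≤ K) (hε : 0 < ε) :
    ∀ᶠ n : ℕ in atTop, ∀ w U : ι → ℝ, (∀ i, 0 ≤ w i) → (∀ i, w i ≤ 1) → (∀ i ∈ S, c ≤ w i) →
      (∀ i, |U i| ≤ K * √(w i)) → ∀ s : E,
      (∀ u, ∑ i, w i * z i s * z i u = ∑ i, U i * z i u) → ∀ b ∈ Θ,
      (∀ θ ∈ Θ, wlsCriterion w U (fun i => √(n : ℝ) * (g i b - g i β)) ≤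
        wlsCriterion w U (fun i => √(n : ℝ) * (g i θ - g i β))) →
      ∀ i, |√(n : ℝ) * (g i b - g i β) - z i s| ≤ ε := by
  obtain ⟨l, hl, hlz⟩ := exists_pos_mul_norm_le z S hinj
  set q : ℝ := ((Fintype.card ι : ℕ) : ℝ) with hq
  have hq0 : 0 ≤ q := Nat.cast_nonneg _
  -- a common bound for the norms of the linear forms
  set Zm : ℝ := ∑ i, ‖z i‖ with hZm
  have hZm0 : 0 ≤ Zm := Finset.sum_nonneg fun i _ => norm_nonneg _
  have hzle : ∀ i u, |z i u| ≤ Zm * ‖u‖ := fun i u => by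
    refine ((z i).le_opNorm u).trans ?_
    gcongr
    exact Finset.single_le_sum (f := fun i => ‖z i‖) (fun j _ => norm_nonneg _)
      (Finset.mem_univ i)
  -- `B1` bounds `√n (g i b - g i β)` for `i ∈ S`, and `B` bounds `√n (b - β)` and `s`
  set B1 : ℝ := K * (1 + q) / √c with hB1
  have hB10 : 0 ≤ B1 := by positivity
  set B : ℝ := max (2 * B1 / l) (q * K * Zm / (c * l ^ 2)) with hB
  have hB0 : 0 ≤ B := le_max_of_le_left (by positivity)
  -- `2 * (η * H)` will bound the loss of criterion through linearization
  set H : ℝ := q * (B * (2 * (Zm * B) + B + 2 * K)) with hH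
  have hH0 : 0 ≤ H := by positivity
  obtain ⟨η, hη0, hη1, hηl, hηε, hηH⟩ : ∃ η > 0, η ≤ 1 ∧ η ≤ l / 2 ∧ η * B ≤ ε / 2 ∧
      η * (Zm ^ 2 * (2 * H / (c * l ^ 2))) ≤ (ε / 2) ^ 2 := by
    have key : ∀ C r : ℝ, 0 < r → ∀ᶠ η in 𝓝[>] (0 : ℝ), η * C ≤ r := fun C r hr => by
      have h0 : Tendsto (fun η : ℝ => η * C) (𝓝[>] 0) (𝓝 0) := by
        have : Tendsto (fun η : ℝ => η * C) (𝓝 0) (𝓝 (0 * C)) :=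
          (continuous_id.mul continuous_const).tendsto 0
        rw [zero_mul] at this
        exact this.mono_left nhdsWithin_le_nhds
      exact (h0.eventually (gt_mem_nhds hr)).mono fun η h => h.le
    obtain ⟨η, h1, h2, h3, h4, h5⟩ := ((key 1 1 one_pos).and ((key 1 (l / 2) (by positivity)).and
      ((key B (ε / 2) (by positivity)).and
        ((key (Zm ^ 2 * (2 * H / (c * l ^ 2))) ((ε / 2) ^ 2) (by positivity)).and
          self_mem_nhdsWithin)))).exists
    exact ⟨η, h5, by simpa using h1, by simpa using h2, h3, h4⟩
  obtain ⟨δ, hδ0, hδ⟩ : ∃ δ > 0, ∀ θ, dist θ β < δ →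
      θ ∈ Θ ∧ ∀ i, |g i θ - g i β - z i (θ - β)| ≤ η * ‖θ - β‖ := by
    have h1 : ∀ i, ∀ᶠ θ in 𝓝 β, |g i θ - g i β - z i (θ - β)| ≤ η * ‖θ - β‖ := fun i =>
      (hasFDerivAt_iff_isLittleO.1 (hz i)).bound hη0
    have h2 : ∀ᶠ θ in 𝓝 β, θ ∈ Θ := mem_interior_iff_mem_nhds.1 hβ
    exact Metric.eventually_nhds_iff.1 (h2.and (eventually_all.2 h1))
  obtain ⟨κ, hκ0, hκ⟩ := hid δ hδ0
  have hsqrt : Tendsto (fun n : ℕ => √(n : ℝ)) atTop atTop :=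
    Real.tendsto_sqrt_atTop.comp tendsto_natCast_atTop_atTop
  filter_upwards [hsqrt.eventually_gt_atTop 0, hsqrt.eventually_gt_atTop (B1 / κ),
    hsqrt.eventually_gt_atTop (B / δ)] with n hn0 hn1 hn2
  intro w U hw hw1 hcw hU s hs b hb hmin
  rw [div_lt_iff₀ hκ0] at hn1
  rw [div_lt_iff₀ hδ0] at hn2
  set r : ℝ := √(n : ℝ) with hr
  have hβΘ : β ∈ Θ := interior_subset hβ
  have hUK : ∀ i, |U i| ≤ K := fun i =>
    (hU i).trans (mul_le_of_le_one_right hK (Real.sqrt_le_one.2 (hw1 i)))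
  -- the criterion at `b` is at most its value `0` at `β`
  have hcrit : wlsCriterion w U (fun i => r * (g i b - g i β)) ≤ 0 :=
    (hmin β hβΘ).trans (by simp [wlsCriterion])
  have hG : ∀ i ∈ S, |r * (g i b - g i β)| ≤ B1 := fun i hi => by
    rw [hB1, le_div_iff₀ (Real.sqrt_pos.2 hc), mul_comm]
    refine le_trans ?_ (sqrt_mul_abs_le_of_wlsCriterion_nonpos hw hK hU hcrit i)
    gcongr
    exact hcw i hi
  -- consistency
  have hbδ : dist b β < δ := by
    by_contra hcon
    obtain ⟨i, hi, hi'⟩ := hκ b hb (not_lt.1 hcon)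
    have h1 := hG i hi
    rw [abs_mul, abs_of_pos hn0] at h1
    nlinarith
  -- the standardized estimate is bounded
  set t : E := r • (b - β) with ht
  have hrem : ∀ i, |r * (g i b - g i β) - z i t| ≤ η * ‖t‖ := fun i => by
    have h1 := (hδ b hbδ).2 i
    have h2 : r * (g i b - g i β) - z i t = r * (g i b - g i β - z i (b - β)) := by
      rw [ht, map_smul, smul_eq_mul]; ring
    rw [h2, abs_mul, abs_of_pos hn0, ht, norm_smul, Real.norm_of_nonneg hn0.le]
    nlinarith
  have htB : ‖t‖ ≤ B := by
    refine le_trans ?_ (le_max_left _ _)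
    have h1 : l * ‖t‖ ≤ B1 + η * ‖t‖ := by
      refine hlz t _ (by positivity) fun i hi => ?_
      have h2 := hG i hi
      have h3 := hrem i
      calc |z i t| = |r * (g i b - g i β) - (r * (g i b - g i β) - z i t)| := by
            rw [sub_sub_cancel]
        _ ≤ _ := abs_sub _ _
        _ ≤ _ := add_le_add h2 h3
    rw [le_div_iff₀ hl]
    nlinarith [norm_nonneg t]
  -- the solution of the normal equations is bounded
  have hsB : ‖s‖ ≤ B := by
    refine le_trans ?_ (le_max_right _ _)
    rw [le_div_iff₀ (by positivity)]
    have h1 := mul_norm_sq_le_sum hl hc hlz hw hcw s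
    have h2 : ∑ i, w i * z i s ^ 2 = ∑ i, U i * z i s := by
      rw [← hs s]
      exact Finset.sum_congr rfl fun i _ => by ring
    have h3 : ∑ i, U i * z i s ≤ q * (K * (Zm * ‖s‖)) := by
      rw [hq, ← nsmul_eq_mul]
      refine Finset.sum_le_card_nsmul _ _ _ fun i _ => ?_
      refine (le_abs_self _).trans ?_
      rw [abs_mul]
      exact mul_le_mul (hUK i) (hzle i s) (abs_nonneg _) hK
    rw [h2] at h1
    rcases (norm_nonneg s).eq_or_lt with h0 | h0
    · rw [← h0, zero_mul]; positivity
    · have h4 : c * l ^ 2 * ‖s‖ * ‖s‖ ≤ q * K * Zm * ‖s‖ := by nlinarith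
      linarith [le_of_mul_le_mul_right h4 h0]
  -- compare with the point `β + s / √n`
  set θ : E := β + r⁻¹ • s with hθ
  have hθβ : θ - β = r⁻¹ • s := by rw [hθ, add_sub_cancel_left]
  have hθδ : dist θ β < δ := by
    rw [dist_eq_norm, hθβ, norm_smul, Real.norm_of_nonneg (by positivity),
      inv_mul_lt_iff₀ hn0]
    exact hsB.trans_lt hn2
  have hremθ : ∀ i, |r * (g i θ - g i β) - z i s| ≤ η * ‖s‖ := fun i => by
    have h1 := (hδ θ hθδ).2 i
    rw [hθβ, map_smul, smul_eq_mul, norm_smul, Real.norm_of_nonneg (by positivity)] at h1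
    have h2 : r * (g i θ - g i β) - z i s = r * (g i θ - g i β - r⁻¹ * z i s) := by
      field_simp
    rw [h2, abs_mul, abs_of_pos hn0]
    calc r * |g i θ - g i β - r⁻¹ * z i s| ≤ r * (η * (r⁻¹ * ‖s‖)) := by gcongr
      _ = η * ‖s‖ := by field_simp
  have hpert : ∀ (y : E) (G : ι → ℝ), ‖y‖ ≤ B → (∀ i, |G i - z i y| ≤ η * ‖y‖) →
      |wlsCriterion w U G - wlsCriterion w U (fun i => z i y)| ≤ η * H := fun y G hy hGy => by
    have h1 := abs_wlsCriterion_sub_le (b := G) (a := fun i => z i y) (A := Zm * B) (η := η * B)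
      hw hw1 hUK
      (fun i => (hzle i y).trans (by gcongr)) (fun i => (hGy i).trans (by gcongr))
    refine h1.trans ?_
    rw [hH, ← hq]
    have h2 : η * B ≤ B := mul_le_of_le_one_left hB0 hη1
    calc q * (η * B * (2 * (Zm * B) + η * B + 2 * K))
        ≤ q * (η * B * (2 * (Zm * B) + B + 2 * K)) := by gcongr
      _ = _ := by ring
  have hsq : ∑ i, w i * (z i (t - s)) ^ 2 ≤ 2 * (η * H) := by
    rw [← wlsCriterion_sub_eq (U := U) (a := fun i => z i s) (hs (t - s))]
    have h1 : (fun i => z i s + z i (t - s)) = fun i => z i t := by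
      funext i; rw [map_sub]; ring
    rw [h1]
    have h2 := abs_le.1 (hpert t _ htB hrem)
    have h3 := abs_le.1 (hpert s _ hsB hremθ)
    have h4 := hmin θ (hδ θ hθδ).1
    linarith [h2.1, h3.2]
  have hts : ‖t - s‖ ^ 2 ≤ η * (2 * H / (c * l ^ 2)) := by
    have h1 := (mul_norm_sq_le_sum hl hc hlz hw hcw (t - s)).trans hsq
    have h2 : η * (2 * H / (c * l ^ 2)) = 2 * (η * H) / (c * l ^ 2) := by ring
    rw [h2, le_div_iff₀ (by positivity)]
    linarith
  intro i
  have h1 : |z i (t - s)| ≤ ε / 2 := by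
    refine (hzle i _).trans ?_
    refine abs_le_of_sq_le_sq' ?_ (by positivity) |>.2
    calc (Zm * ‖t - s‖) ^ 2 = Zm ^ 2 * ‖t - s‖ ^ 2 := by ring
      _ ≤ Zm ^ 2 * (η * (2 * H / (c * l ^ 2))) := by gcongr
      _ = η * (Zm ^ 2 * (2 * H / (c * l ^ 2))) := by ring
      _ ≤ _ := hηH
  have h2 : |r * (g i b - g i β) - z i t| ≤ ε / 2 :=
    (hrem i).trans ((mul_le_mul_of_nonneg_left htB hη0.le).trans hηε)
  have h3 : r * (g i b - g i β) - z i s = (r * (g i b - g i β) - z i t) + z i (t - s) := by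
    rw [map_sub]; ring
  rw [h3]
  exact (abs_add_le _ _).trans (by linarith)

end LeastSquares

end MissingDesign

/-! ### The likelihood and the normal equations of the incomplete design -/

namespace MissingDesign

section Model

variable {X : Type*} {N p : ℕ} {cnt : Fin N → ℕ}

/-- The sum of the errors of the responses observed at the `i`-th point. -/
noncomputable def observedSum (m : Pattern cnt) (e : RealArray cnt) (i : Fin N) : ℝ :=
  ∑ j, if m i j = true then e i j else 0

/-- The share of the `n` planned observations that is observed at the `i`-th point. -/
noncomputable def observedShare (n : ℕ) (m : Pattern cnt) (i : Fin N) : ℝ :=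
  (observedCount m i : ℝ) / n

/-- The data vector of the standardized least squares problem: at the `i`-th point, the sum of
the deviations of the observed responses from `f (x i) β`, divided by `√n`. -/
noncomputable def dataVector (Ψ : Fin N → ℝ) (n : ℕ) (m : Pattern cnt) (e : RealArray cnt)
    (i : Fin N) : ℝ :=
  observedShare n m i * Ψ i + observedSum m e i / √(n : ℝ)

lemma observedCount_eq_sum (m : Pattern cnt) (i : Fin N) :
    (observedCount m i : ℝ) = ∑ j, if m i j = true then (1 : ℝ) else 0 := by
  simp [observedCount]

lemma observedCount_le (m : Pattern cnt) {n : ℕ} (hcnt : ∑ i, cnt i = n) (i : Fin N) :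
    observedCount m i ≤ n := by
  calc observedCount m i ≤ ∑ _j : Fin (cnt i), 1 :=
        Finset.sum_le_sum fun j _ => by split_ifs <;> simp
    _ = cnt i := by simp
    _ ≤ ∑ i, cnt i := Finset.single_le_sum (f := cnt) (fun _ _ => Nat.zero_le _)
        (Finset.mem_univ i)
    _ = n := hcnt

lemma observedShare_nonneg (n : ℕ) (m : Pattern cnt) (i : Fin N) : 0 ≤ observedShare n m i :=
  div_nonneg (Nat.cast_nonneg _) (Nat.cast_nonneg _)

lemma observedShare_le_one (m : Pattern cnt) {n : ℕ} (hcnt : ∑ i, cnt i = n) (i : Fin N) :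
    observedShare n m i ≤ 1 :=
  div_le_one_of_le₀ (by exact_mod_cast observedCount_le m hcnt i) (Nat.cast_nonneg _)

/-- The residual sum of squares over the observed responses. -/
noncomputable def residualSS (f : X → EuclideanSpace ℝ (Fin p) → ℝ) (x : Fin N → X)
    (m : Pattern cnt) (y : RealArray cnt) (θ : EuclideanSpace ℝ (Fin p)) : ℝ :=
  ∑ i, ∑ j, if m i j = true then (y i j - f (x i) θ) ^ 2 else 0

lemma completeCaseLikelihood_eq (f : X → EuclideanSpace ℝ (Fin p) → ℝ) (x : Fin N → X)
    (v : ℝ≥0) (m : Pattern cnt) (y : RealArray cnt) (θ : EuclideanSpace ℝ (Fin p)) :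
    completeCaseLikelihood f x v m y θ
      = (∏ i, ∏ j, if m i j = true then (√(2 * Real.pi * v))⁻¹ else 1)
        * Real.exp (-residualSS f x m y θ / (2 * v)) := by
  have h : -residualSS f x m y θ / (2 * v)
      = ∑ i, ∑ j, if m i j = true then -(y i j - f (x i) θ) ^ 2 / (2 * v) else 0 := by
    unfold residualSS
    rw [← Finset.sum_neg_distrib, Finset.sum_div]
    refine Finset.sum_congr rfl fun i _ => ?_
    rw [← Finset.sum_neg_distrib, Finset.sum_div]
    refine Finset.sum_congr rfl fun j _ => ?_
    split_ifs <;> simp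
  rw [h, Real.exp_sum, ← Finset.prod_mul_distrib]
  refine Finset.prod_congr rfl fun i _ => ?_
  rw [Real.exp_sum, ← Finset.prod_mul_distrib]
  refine Finset.prod_congr rfl fun j _ => ?_
  split_ifs <;> simp [gaussianPDFReal]

/-- Under the exact model the residual sum of squares is, up to a constant, the standardized
weighted least squares criterion. -/
lemma residualSS_response (f : X → EuclideanSpace ℝ (Fin p) → ℝ) (x : Fin N → X)
    (β : EuclideanSpace ℝ (Fin p)) (Ψ : Fin N → ℝ) {n : ℕ} (hn : 0 < n) (m : Pattern cnt)
    (e : RealArray cnt) (θ : EuclideanSpace ℝ (Fin p)) :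
    residualSS f x m (response f x β Ψ n e) θ
      = wlsCriterion (observedShare n m) (dataVector Ψ n m e)
          (fun i => √(n : ℝ) * (f (x i) θ - f (x i) β))
        + residualSS f x m (response f x β Ψ n e) β := by
  unfold residualSS wlsCriterion
  rw [← Finset.sum_add_distrib]
  refine Finset.sum_congr rfl fun i _ => ?_
  set r := √(n : ℝ) with hr
  have hn' : (0 : ℝ) < n := by exact_mod_cast hn
  have hr0 : r ≠ 0 := (Real.sqrt_pos.2 hn').ne'
  have hrr : (n : ℝ) = r ^ 2 := (Real.sq_sqrt hn'.le).symm
  set d := f (x i) θ - f (x i) β with hd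
  have h1 : observedShare n m i * (r * d) ^ 2 - 2 * dataVector Ψ n m e i * (r * d)
      = observedCount m i * (d ^ 2 - 2 * d * (Ψ i / r)) - 2 * d * observedSum m e i := by
    unfold dataVector observedShare
    rw [← hr, hrr]
    field_simp
    ring
  rw [h1, observedCount_eq_sum, observedSum, Finset.sum_mul, Finset.mul_sum,
    ← Finset.sum_sub_distrib, ← Finset.sum_add_distrib]
  refine Finset.sum_congr rfl fun j _ => ?_
  split_ifs
  · simp only [response]
    rw [← hr, show f (x i) θ = d + f (x i) β by rw [hd]; ring]
    ring
  · ring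

/-- Complete-case maximum likelihood is weighted least squares. -/
lemma IsCompleteCaseMLE.wlsCriterion_le {f : X → EuclideanSpace ℝ (Fin p) → ℝ} {x : Fin N → X}
    {β : EuclideanSpace ℝ (Fin p)} {Ψ : Fin N → ℝ} {n : ℕ} (hn : 0 < n) {m : Pattern cnt}
    {e : RealArray cnt} {Θ : Set (EuclideanSpace ℝ (Fin p))} {v : ℝ≥0} (hv : 0 < v)
    {b : EuclideanSpace ℝ (Fin p)}
    (h : IsCompleteCaseMLE f x Θ v m (response f x β Ψ n e) b)
    {θ : EuclideanSpace ℝ (Fin p)} (hθ : θ ∈ Θ) :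
    wlsCriterion (observedShare n m) (dataVector Ψ n m e)
        (fun i => √(n : ℝ) * (f (x i) b - f (x i) β))
      ≤ wlsCriterion (observedShare n m) (dataVector Ψ n m e)
        (fun i => √(n : ℝ) * (f (x i) θ - f (x i) β)) := by
  have h1 := h.2 θ hθ
  have hv' : (0 : ℝ) < v := by exact_mod_cast hv
  have hpos : 0 < ∏ i : Fin N, ∏ j, if m i j = true then (√(2 * Real.pi * v))⁻¹ else 1 :=
    Finset.prod_pos fun i _ => Finset.prod_pos fun j _ => by split_ifs <;> positivity
  rw [completeCaseLikelihood_eq, completeCaseLikelihood_eq, mul_le_mul_iff_right₀ hpos,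
    Real.exp_le_exp, div_le_div_iff_of_pos_right (by positivity), neg_le_neg_iff,
    residualSS_response f x β Ψ hn m e θ, residualSS_response f x β Ψ hn m e b] at h1
  linarith

/-- The data vector is small where the weights are small, provided the error sums are. -/
lemma abs_dataVector_le {Ψ : Fin N → ℝ} {n : ℕ} (hn : 0 < n) {m : Pattern cnt}
    (hcnt : ∑ i, cnt i = n) {e : RealArray cnt} {R : ℝ} {i : Fin N}
    (h : |observedSum m e i| ≤ R * √(observedCount m i : ℝ)) :
    |dataVector Ψ n m e i| ≤ (R + ∑ k, |Ψ k|) * √(observedShare n m i) := by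
  have hn' : (0 : ℝ) < n := by exact_mod_cast hn
  have h0 := observedShare_nonneg n m i
  have hle : observedShare n m i ≤ √(observedShare n m i) := by
    refine Real.le_sqrt_of_sq_le ?_
    nlinarith [observedShare_le_one m hcnt i]
  have h1 : |observedShare n m i * Ψ i| ≤ (∑ k, |Ψ k|) * √(observedShare n m i) := by
    rw [abs_mul, abs_of_nonneg h0, mul_comm]
    exact mul_le_mul (Finset.single_le_sum (f := fun k => |Ψ k|) (fun _ _ => abs_nonneg _)
      (Finset.mem_univ i)) hle h0 (Finset.sum_nonneg fun _ _ => abs_nonneg _)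
  have h2 : |observedSum m e i / √(n : ℝ)| ≤ R * √(observedShare n m i) := by
    rw [abs_div, abs_of_nonneg (Real.sqrt_nonneg _), div_le_iff₀ (Real.sqrt_pos.2 hn'),
      mul_assoc, ← Real.sqrt_mul h0, observedShare, div_mul_cancel₀ _ hn'.ne']
    exact h
  unfold dataVector
  refine (abs_add_le _ _).trans ?_
  linarith

variable (f : X → EuclideanSpace ℝ (Fin p) → ℝ) (x : Fin N → X) (β : EuclideanSpace ℝ (Fin p))

lemma fderiv_apply_eq_mulVec (i : Fin N) (u : EuclideanSpace ℝ (Fin p)) :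
    fderiv ℝ (f (x i)) β u = (matZ f x β *ᵥ u.ofLp) i := by
  conv_lhs => rw [← (EuclideanSpace.basisFun (Fin p) ℝ).sum_repr u]
  rw [map_sum]
  simp only [map_smul, EuclideanSpace.basisFun_apply, EuclideanSpace.basisFun_repr, smul_eq_mul,
    Matrix.mulVec, dotProduct, matZ, Matrix.of_apply]
  exact Finset.sum_congr rfl fun k _ => mul_comm _ _

lemma dotProduct_infoMatrix_mulVec (m : Pattern cnt) (a b : Fin p → ℝ) :
    a ⬝ᵥ (infoMatrix f x β m *ᵥ b)
      = ∑ i, observedCount m i * (matZ f x β *ᵥ b) i * (matZ f x β *ᵥ a) i := by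
  unfold infoMatrix
  rw [Matrix.mul_assoc, ← Matrix.mulVec_mulVec, ← Matrix.mulVec_mulVec, Matrix.dotProduct_mulVec,
    Matrix.vecMul_transpose]
  simp only [dotProduct, matD, Matrix.mulVec_diagonal]
  exact Finset.sum_congr rfl fun k _ => mul_comm _ _

lemma infoMatrix_transpose (m : Pattern cnt) :
    (infoMatrix f x β m)ᵀ = infoMatrix f x β m := by
  simp [infoMatrix, matD, Matrix.transpose_mul, Matrix.mul_assoc]

variable {f x β}

/-- Full column rank of the rows in `S` means that their gradients separate points. -/
lemma eq_zero_of_fderiv_eq_zero {S : Finset (Fin N)}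
    (hS : LinearIndependent ℝ (fun (k : Fin p) (i : S) => matZ f x β i k))
    (u : EuclideanSpace ℝ (Fin p)) (hu : ∀ i ∈ S, fderiv ℝ (f (x i)) β u = 0) : u = 0 := by
  have h := Fintype.linearIndependent_iff.1 hS u.ofLp (by
    funext i
    have := hu i i.2
    rw [fderiv_apply_eq_mulVec] at this
    rw [Finset.sum_apply]
    simpa [Matrix.mulVec, dotProduct, mul_comm] using this)
  ext k
  exact h k

lemma isUnit_infoMatrix {S : Finset (Fin N)}
    (hS : LinearIndependent ℝ (fun (k : Fin p) (i : S) => matZ f x β i k)) {m : Pattern cnt}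
    (hm : ∀ i ∈ S, 0 < (observedCount m i : ℝ)) : IsUnit (infoMatrix f x β m) := by
  rw [← Matrix.mulVec_injective_iff_isUnit, ← Matrix.coe_mulVecLin, injective_iff_map_eq_zero]
  intro u hu
  rw [Matrix.mulVecLin_apply] at hu
  have h1 := dotProduct_infoMatrix_mulVec f x β m u u
  rw [hu, dotProduct_zero] at h1
  have h2 : ∀ i ∈ Finset.univ,
      (observedCount m i : ℝ) * (matZ f x β *ᵥ u) i * (matZ f x β *ᵥ u) i = 0 :=
    (Finset.sum_eq_zero_iff_of_nonneg fun i _ => by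
      rw [mul_assoc]
      exact mul_nonneg (Nat.cast_nonneg _) (mul_self_nonneg _)).1 h1.symm
  have h3 := eq_zero_of_fderiv_eq_zero hS (WithLp.toLp 2 u) fun i hi => by
    rw [fderiv_apply_eq_mulVec]
    have := h2 i (Finset.mem_univ i)
    rw [mul_assoc] at this
    simpa [(hm i hi).ne'] using this
  simpa using congrArg WithLp.ofLp h3

variable (f x β)

/-- The entries `z_iᵀ (Zᵀ D_{ξM} Z)⁻¹ z_k`. -/
noncomputable def gramEntry (m : Pattern cnt) (i k : Fin N) : ℝ :=
  matZ f x β i ⬝ᵥ ((infoMatrix f x β m)⁻¹ *ᵥ matZ f x β k)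

lemma dotProduct_inv_mulVec_transpose (m : Pattern cnt) (i : Fin N) (y : Fin N → ℝ) :
    matZ f x β i ⬝ᵥ ((infoMatrix f x β m)⁻¹ *ᵥ ((matZ f x β)ᵀ *ᵥ y))
      = ∑ k, gramEntry f x β m i k * y k := by
  rw [Matrix.dotProduct_mulVec, Matrix.dotProduct_mulVec, Matrix.vecMul_transpose, dotProduct]
  refine Finset.sum_congr rfl fun k _ => ?_
  rw [gramEntry, Matrix.dotProduct_mulVec, Matrix.mulVec, dotProduct_comm]

lemma gramEntry_comm (m : Pattern cnt) (i k : Fin N) :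
    gramEntry f x β m i k = gramEntry f x β m k i := by
  rw [gramEntry, gramEntry, Matrix.dotProduct_mulVec, dotProduct_comm, ← Matrix.mulVec_transpose,
    Matrix.transpose_nonsing_inv, infoMatrix_transpose]

lemma asympMean_eq_sum (Ψ : Fin N → ℝ) (m : Pattern cnt) (i : Fin N) :
    asympMean f x β Ψ m i = ∑ k, gramEntry f x β m i k * (observedCount m k * Ψ k) := by
  rw [asympMean, ← Matrix.mulVec_mulVec, ← Matrix.mulVec_mulVec, dotProduct_inv_mulVec_transpose]
  simp [matD, Matrix.mulVec_diagonal]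

/-- The approximating normal variable: the asymptotic mean plus a linear combination of the
observed errors. -/
noncomputable def normalApprox (Ψ : Fin N → ℝ) (n : ℕ) (m : Pattern cnt) (e : RealArray cnt)
    (i : Fin N) : ℝ :=
  asympMean f x β Ψ m i + √(n : ℝ) * ∑ k, gramEntry f x β m i k * observedSum m e k

/-- The normal equations of the linearized problem have a solution whose `i`-th fitted value is
the approximating normal variable. -/
lemma exists_normalEquations (Ψ : Fin N → ℝ) {n : ℕ} (hn : 0 < n) {m : Pattern cnt}
    (hm : IsUnit (infoMatrix f x β m)) (e : RealArray cnt) :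
    ∃ s : EuclideanSpace ℝ (Fin p),
      (∀ u, ∑ i, observedShare n m i * fderiv ℝ (f (x i)) β s * fderiv ℝ (f (x i)) β u
        = ∑ i, dataVector Ψ n m e i * fderiv ℝ (f (x i)) β u) ∧
      ∀ i, fderiv ℝ (f (x i)) β s = normalApprox f x β Ψ n m e i := by
  have hn' : (0 : ℝ) < n := by exact_mod_cast hn
  have hr0 : √(n : ℝ) ≠ 0 := (Real.sqrt_pos.2 hn').ne'
  set t : Fin p → ℝ :=
    (infoMatrix f x β m)⁻¹ *ᵥ ((matZ f x β)ᵀ *ᵥ dataVector Ψ n m e) with ht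
  have hs : ∀ i, fderiv ℝ (f (x i)) β ((n : ℝ) • WithLp.toLp 2 t)
      = n * (matZ f x β *ᵥ t) i := fun i => by
    rw [map_smul, fderiv_apply_eq_mulVec, smul_eq_mul]
  refine ⟨(n : ℝ) • WithLp.toLp 2 t, fun u => ?_, fun i => ?_⟩
  · have h1 := dotProduct_infoMatrix_mulVec f x β m u.ofLp t
    rw [ht, Matrix.mulVec_mulVec _ (infoMatrix f x β m),
      Matrix.mul_nonsing_inv _ ((Matrix.isUnit_iff_isUnit_det _).1 hm), Matrix.one_mulVec, ← ht,
      Matrix.dotProduct_mulVec, Matrix.vecMul_transpose, dotProduct_comm] at h1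
    simp only [hs, fderiv_apply_eq_mulVec]
    rw [dotProduct] at h1
    rw [h1]
    refine Finset.sum_congr rfl fun i _ => ?_
    rw [observedShare]
    field_simp
  · rw [hs, Matrix.mulVec, ht, dotProduct_inv_mulVec_transpose, normalApprox, asympMean_eq_sum,
      Finset.mul_sum, Finset.mul_sum, ← Finset.sum_add_distrib]
    refine Finset.sum_congr rfl fun k _ => ?_
    have hrr : (n : ℝ) = √(n : ℝ) ^ 2 := (Real.sq_sqrt hn'.le).symm
    rw [dataVector, observedShare]
    set r := √(n : ℝ)
    rw [hrr]
    field_simp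

/-- The Gram matrix `Z (Zᵀ D Z)⁻¹ Zᵀ` is a generalized inverse of `D`. -/
lemma sum_observedCount_mul_gramEntry_sq {m : Pattern cnt} (hm : IsUnit (infoMatrix f x β m))
    (i : Fin N) :
    ∑ k, observedCount m k * gramEntry f x β m i k ^ 2 = gramEntry f x β m i i := by
  set t : Fin p → ℝ := (infoMatrix f x β m)⁻¹ *ᵥ matZ f x β i with ht
  have h1 := dotProduct_infoMatrix_mulVec f x β m t t
  have h2 : ∀ k, (matZ f x β *ᵥ t) k = gramEntry f x β m i k := fun k => by
    rw [gramEntry_comm]; rfl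
  rw [show infoMatrix f x β m *ᵥ t = matZ f x β i by
    rw [ht, Matrix.mulVec_mulVec,
      Matrix.mul_nonsing_inv _ ((Matrix.isUnit_iff_isUnit_det _).1 hm), Matrix.one_mulVec],
    dotProduct_comm] at h1
  simp only [h2] at h1
  rw [gramEntry, ← ht, h1]
  exact Finset.sum_congr rfl fun k _ => by ring

/-! ### Laws of linear statistics of the observed errors -/

variable {Ω : Type*} [MeasurableSpace Ω] {P : Measure Ω} [IsProbabilityMeasure P] {v : ℝ≥0}
  {e : Ω → RealArray cnt}

lemma hasLaw_sum_mul_observedSum (he_law : ∀ i j, HasLaw (fun ω => e ω i j) (gaussianReal 0 v) P)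
    (he_indep : iIndepFun (fun (k : Σ i, Fin (cnt i)) ω => e ω k.1 k.2) P) (m : Pattern cnt)
    (a : Fin N → ℝ) :
    HasLaw (fun ω => ∑ k, a k * observedSum m (e ω) k)
      (gaussianReal 0 ((∑ k, observedCount m k * a k ^ 2) * v).toNNReal) P := by
  have h := hasLaw_sum_mul_gaussianReal
    (fun k : Σ i, Fin (cnt i) => he_law k.1 k.2) he_indep (fun k => if m k.1 k.2 = true then a k.1 else 0)
  convert h using 1
  · funext ω
    rw [Fintype.sum_sigma]
    refine Finset.sum_congr rfl fun k _ => ?_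
    rw [observedSum, Finset.mul_sum]
    refine Finset.sum_congr rfl fun j _ => ?_
    split_ifs <;> simp
  · congr 3
    rw [Fintype.sum_sigma]
    refine Finset.sum_congr rfl fun k _ => ?_
    rw [observedCount_eq_sum, Finset.sum_mul]
    refine Finset.sum_congr rfl fun j _ => ?_
    split_ifs <;> simp

/-- For a fixed missingness pattern the approximating normal variable has the asymptotic mean and
the asymptotic variance. -/
lemma hasLaw_normalApprox (he_law : ∀ i j, HasLaw (fun ω => e ω i j) (gaussianReal 0 v) P)
    (he_indep : iIndepFun (fun (k : Σ i, Fin (cnt i)) ω => e ω k.1 k.2) P) (Ψ : Fin N → ℝ)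
    (n : ℕ) {m : Pattern cnt} (hm : IsUnit (infoMatrix f x β m)) (i : Fin N) :
    HasLaw (fun ω => normalApprox f x β Ψ n m (e ω) i)
      (gaussianReal (asympMean f x β Ψ m i) (asympVar f x β v n m i).toNNReal) P := by
  have h := gaussianReal_const_add (hasLaw_sum_mul_observedSum he_law he_indep m
    (fun k => √(n : ℝ) * gramEntry f x β m i k)) (asympMean f x β Ψ m i)
  convert h using 1
  · funext ω
    rw [normalApprox, Finset.mul_sum]
    simp_rw [mul_assoc]
  · rw [zero_add]
    congr 2
    have h1 : ∀ k, (observedCount m k : ℝ) * (√(n : ℝ) * gramEntry f x β m i k) ^ 2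
        = n * (observedCount m k * gramEntry f x β m i k ^ 2) := fun k => by
      rw [mul_pow, Real.sq_sqrt (Nat.cast_nonneg _)]; ring
    simp_rw [h1]
    rw [← Finset.mul_sum, sum_observedCount_mul_gramEntry_sq f x β hm, asympVar]
    unfold gramEntry
    ring

/-- Chebyshev's inequality for the sum of the observed errors at a point. -/
lemma measure_lt_abs_observedSum_le
    (he_law : ∀ i j, HasLaw (fun ω => e ω i j) (gaussianReal 0 v) P)
    (he_indep : iIndepFun (fun (k : Σ i, Fin (cnt i)) ω => e ω k.1 k.2) P) (m : Pattern cnt)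
    (i : Fin N) {R : ℝ} (hR : 0 < R) :
    P {ω | R * √(observedCount m i : ℝ) < |observedSum m (e ω) i|}
      ≤ ENNReal.ofReal (v / R ^ 2) := by
  rcases Nat.eq_zero_or_pos (observedCount m i) with h0 | h0
  · have h1 : ∀ j, m i j ≠ true := fun j hj => by
      have := (Finset.sum_eq_zero_iff.1 h0) j (Finset.mem_univ j)
      simp [hj] at this
    have h2 : ∀ ω, observedSum m (e ω) i = 0 := fun ω =>
      Finset.sum_eq_zero fun j _ => if_neg (h1 j)
    simp [h0, h2]
  · have hpos : (0 : ℝ) < observedCount m i := by exact_mod_cast h0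
    have hlaw : HasLaw (fun ω => observedSum m (e ω) i)
        (gaussianReal 0 (observedCount m i * v : ℝ).toNNReal) P := by
      have h := hasLaw_sum_mul_observedSum he_law he_indep m (Pi.single i 1)
      convert h using 1
      · funext ω; simp [Pi.single_apply]
      · simp [Pi.single_apply]
    have hint : P[fun ω => observedSum m (e ω) i] = 0 := by
      rw [hlaw.integral_eq, integral_id_gaussianReal]
    have hvar : Var[fun ω => observedSum m (e ω) i; P] = observedCount m i * v := by
      rw [hlaw.variance_eq, variance_id_gaussianReal, Real.coe_toNNReal _ (by positivity)]
    have hmem : MemLp (fun ω => observedSum m (e ω) i) 2 P := by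
      have h := memLp_id_gaussianReal (μ := 0) (v := (observedCount m i * v : ℝ).toNNReal) 2
      rw [← hlaw.map_eq] at h
      exact (memLp_map_measure_iff aestronglyMeasurable_id hlaw.aemeasurable).1 h
    have h := meas_ge_le_variance_div_sq hmem (c := R * √(observedCount m i : ℝ)) (by positivity)
    rw [hint, hvar, mul_pow, Real.sq_sqrt hpos.le, mul_comm (R ^ 2),
      mul_div_mul_left _ _ hpos.ne'] at h
    refine le_trans (measure_mono fun ω hω => ?_) h
    simpa using le_of_lt hω

end Model

end MissingDesign

/-! ### Convergence in probability -/

namespace MissingDesign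

section Asymptotics

variable {X Ω : Type*} [MeasurableSpace Ω] {P : Measure Ω}

/-- Finitely many sequences of exact order `n` have a common lower bound of order `n`. -/
lemma exists_forall_mem_mul_le {ι : Type*} {A : ι → ℕ → Ω → ℝ} (S : Finset ι)
    (h : ∀ i ∈ S, IsExactOrderInProb P (A i) (fun n => (n : ℝ))) {η : ℝ≥0∞} (hη : 0 < η) :
    ∃ c : ℝ, 0 < c ∧ ∀ᶠ n : ℕ in atTop, P {ω | ¬ ∀ i ∈ S, c * n ≤ A i n ω} ≤ η := by
  classical
  induction S using Finset.induction generalizing η with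
  | empty => exact ⟨1, one_pos, by simp⟩
  | insert a S _ ih =>
    have hη2 : 0 < η / 2 := ENNReal.half_pos hη.ne'
    obtain ⟨c₁, hc₁, h₁⟩ := ih (fun i hi => h i (Finset.mem_insert_of_mem hi)) hη2
    obtain ⟨c₂, C, hc₂, h₂⟩ := h a (Finset.mem_insert_self a S) (η / 2) hη2
    refine ⟨min c₁ c₂, lt_min hc₁ hc₂, ?_⟩
    filter_upwards [h₁, h₂] with n hn₁ hn₂
    rw [← ENNReal.add_halves η]
    refine (measure_mono fun ω hω => ?_).trans ((measure_union_le _ _).trans (add_le_add hn₁ hn₂))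
    by_contra hcon
    rw [Set.mem_union, not_or] at hcon
    simp only [Set.mem_ofPred_eq, not_not] at hcon
    refine hω fun i hi => ?_
    rcases Finset.mem_insert.1 hi with rfl | hi
    · refine le_trans ?_ hcon.2.1
      gcongr
      exact min_le_right _ _
    · refine le_trans ?_ (hcon.1 i hi)
      gcongr
      exact min_le_left _ _

variable [IsProbabilityMeasure P] {N p : ℕ}

lemma measurable_observedSum {cnt : Fin N → ℕ} (m : Pattern cnt) (i : Fin N) :
    Measurable fun e : RealArray cnt => observedSum m e i := by
  unfold observedSum
  refine Finset.measurable_fun_sum _ fun j _ => ?_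
  split_ifs <;> fun_prop

lemma measurable_normalApprox {cnt : Fin N → ℕ} (f : X → EuclideanSpace ℝ (Fin p) → ℝ)
    (x : Fin N → X) (β : EuclideanSpace ℝ (Fin p)) (Ψ : Fin N → ℝ) (n : ℕ) (m : Pattern cnt)
    (i : Fin N) : Measurable fun e : RealArray cnt => normalApprox f x β Ψ n m e i := by
  unfold normalApprox
  refine Measurable.const_add (Measurable.const_mul ?_ _) _
  exact Finset.measurable_fun_sum _ fun k _ => (measurable_observedSum m k).const_mul _

/-- Chebyshev's inequality for the sums of the observed errors, uniformly in the random
missingness pattern. -/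
lemma measure_exists_lt_abs_observedSum_le {cnt : Fin N → ℕ} {M : Ω → Pattern cnt}
    (hM : Measurable M) {e : Ω → RealArray cnt} {v : ℝ≥0}
    (he_law : ∀ i j, HasLaw (fun ω => e ω i j) (gaussianReal 0 v) P)
    (he_indep : iIndepFun (fun (k : Σ i, Fin (cnt i)) ω => e ω k.1 k.2) P)
    (hMe : IndepFun M e P) {R : ℝ} (hR : 0 < R) :
    P {ω | ∃ i, R * √(observedCount (M ω) i : ℝ) < |observedSum (M ω) (e ω) i|}
      ≤ N * ENNReal.ofReal (v / R ^ 2) := by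
  have h1 : ∀ i, P {ω | R * √(observedCount (M ω) i : ℝ) < |observedSum (M ω) (e ω) i|}
      ≤ ENNReal.ofReal (v / R ^ 2) := fun i => by
    refine measure_le_of_forall_fiber_le hM
      (fun m => {ω | R * √(observedCount m i : ℝ) < |observedSum m (e ω) i|}) fun m => ?_
    have hB : MeasurableSet {y : RealArray cnt |
        R * √(observedCount m i : ℝ) < |observedSum m y i|} :=
      measurableSet_lt measurable_const (measurable_observedSum m i).abs
    have h2 := hMe.measure_inter_preimage_eq_mul {m} _ (measurableSet_singleton m) hB
    refine h2.le.trans ?_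
    gcongr
    exact measure_lt_abs_observedSum_le he_law he_indep m i hR
  have hset : {ω | ∃ i, R * √(observedCount (M ω) i : ℝ) < |observedSum (M ω) (e ω) i|}
      = ⋃ i ∈ (Finset.univ : Finset (Fin N)),
        {ω | R * √(observedCount (M ω) i : ℝ) < |observedSum (M ω) (e ω) i|} := by
    ext ω; simp
  rw [hset]
  refine (measure_biUnion_finset_le _ _).trans ?_
  refine (Finset.sum_le_card_nsmul _ _ _ fun i _ => h1 i).trans ?_
  simp

lemma exists_nat_mul_ofReal_div_sq_le (N : ℕ) (v : ℝ≥0) {η : ℝ≥0∞} (hη : 0 < η) :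
    ∃ R : ℝ, 0 < R ∧ N * ENNReal.ofReal (v / R ^ 2) ≤ η := by
  have h1 : Tendsto (fun R : ℝ => (v : ℝ) / R ^ 2) atTop (𝓝 0) :=
    tendsto_const_nhds.div_atTop (tendsto_pow_atTop two_ne_zero)
  have h2 : Tendsto (fun R : ℝ => (N : ℝ≥0∞) * ENNReal.ofReal (v / R ^ 2)) atTop (𝓝 0) := by
    have := ENNReal.Tendsto.const_mul (a := (N : ℝ≥0∞)) (ENNReal.tendsto_ofReal h1)
      (Or.inr (ENNReal.natCast_ne_top N))
    simpa using this
  obtain ⟨R, hR1, hR2⟩ := ((ENNReal.tendsto_nhds_zero.1 h2 η hη).and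
    (eventually_gt_atTop 0)).exists
  exact ⟨R, hR2, hR1⟩

end Asymptotics

end MissingDesign

open MissingDesign in
theorem mainTheorem5 {X Ω : Type*} [MeasurableSpace Ω] (P : Measure Ω) [IsProbabilityMeasure P]
    {N p : ℕ}
    -- the regression function, the design space, the parameter space, the parameter,
    -- the misspecification and the error variance
    (f : X → EuclideanSpace ℝ (Fin p) → ℝ) (x : Fin N → X)
    (Θ : Set (EuclideanSpace ℝ (Fin p))) (β : EuclideanSpace ℝ (Fin p))
    (Ψ : Fin N → ℝ) (v : ℝ≥0) (hv : 0 < v)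
    -- the numbers `cnt n i` of observations at `x i` when `n` observations are made in total
    (cnt : ℕ → Fin N → ℕ) (hcnt : ∀ n, ∑ i, cnt n i = n)
    -- the missing indicators
    (M : (n : ℕ) → Ω → Pattern (cnt n)) (hM : ∀ n, Measurable (M n))
    -- the errors: independent, normal, and independent of the missing indicators
    (e : (n : ℕ) → Ω → RealArray (cnt n))
    (he_law : ∀ n i j, HasLaw (fun ω => e n ω i j) (gaussianReal 0 v) P)
    (he_indep : ∀ n, iIndepFun (fun (k : Σ i, Fin (cnt n i)) ω => e n ω k.1 k.2) P)
    (hMe : ∀ n, IndepFun (M n) (e n) P)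
    -- regularity of the regression function
    (hf_meas : ∀ i, Measurable (f (x i)))
    (hf_smooth : ∀ i, ContDiffAt ℝ 2 (f (x i)) β)
    (hβ : β ∈ interior Θ)
    -- at the design points in `S` the numbers of observed responses are of exact order `n`,
    -- and these points identify `β`, locally to first order and globally
    (S : Finset (Fin N))
    (hS_order : ∀ i ∈ S,
      IsExactOrderInProb P (fun n ω => (observedCount (M n ω) i : ℝ)) (fun n => (n : ℝ)))
    (hS_rank : LinearIndependent ℝ (fun (k : Fin p) (i : S) => matZ f x β i k))
    (hS_ident : IsIdentified f x Θ S β)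
    -- the complete-case maximum likelihood estimates
    (bhat : ℕ → Ω → EuclideanSpace ℝ (Fin p)) (hb_meas : ∀ n, AEMeasurable (bhat n) P)
    (hb_mle : Tendsto (fun n => P {ω | ¬ IsCompleteCaseMLE f x Θ v (M n ω)
      (response f x β Ψ n (e n ω)) (bhat n ω)}) atTop (𝓝 0)) :
    -- the matrix `ZᵀDZ` is invertible with probability tending to one
    Tendsto (fun n => P {ω | ¬ IsUnit (infoMatrix f x β (M n ω))}) atTop (𝓝 0) ∧
    -- the conditional law given the missing indicators is asymptotically normal: its
    -- Lévy-Prokhorov distance to the normal law tends to zero in probability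
    ∀ i : Fin N, TendstoInMeasure P
      (fun n ω => levyProkhorovDist
        (condLaw P (M n) (fun ω' => √(n : ℝ) * (f (x i) (bhat n ω') - f (x i) β)) (M n ω))
        (gaussianReal (asympMean f x β Ψ (M n ω) i)
          (asympVar f x β v n (M n ω) i).toNNReal))
      atTop (fun _ => 0) := by
  -- the design matrix has full rank as soon as a positive share is observed at each point of `S`
  have hunit : Tendsto (fun n => P {ω | ¬ IsUnit (infoMatrix f x β (M n ω))}) atTop (𝓝 0) := by
    refine ENNReal.tendsto_nhds_zero.2 fun η hη => ?_
    obtain ⟨c, hc, hcn⟩ := exists_forall_mem_mul_le S hS_order hη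
    filter_upwards [hcn, eventually_gt_atTop 0] with n hn hn0
    refine le_trans (measure_mono fun ω hω => ?_) hn
    rw [Set.mem_ofPred_eq] at hω ⊢
    refine fun h => hω ?_
    have hn0' : (0 : ℝ) < n := by exact_mod_cast hn0
    exact isUnit_infoMatrix hS_rank fun i hi => (mul_pos hc hn0').trans_le (h i hi)
  refine ⟨hunit, fun i => ?_⟩
  -- unconditional approximation of the standardized estimate by a normal variable
  have happrox : ∀ ε : ℝ, 0 < ε → Tendsto (fun n : ℕ => P {ω | ε ≤
      |√(n : ℝ) * (f (x i) (bhat n ω) - f (x i) β)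
        - normalApprox f x β Ψ n (M n ω) (e n ω) i|}) atTop (𝓝 0) := by
    intro ε hε
    refine ENNReal.tendsto_nhds_zero.2 fun η hη => ?_
    have hη3 : 0 < η / 3 := ENNReal.div_pos hη.ne' (by simp)
    obtain ⟨c, hc, hcn⟩ := exists_forall_mem_mul_le S hS_order hη3
    obtain ⟨R, hR, hRη⟩ := exists_nat_mul_ofReal_div_sq_le N v hη3
    have hK : 0 ≤ R + ∑ k, |Ψ k| := add_nonneg hR.le (Finset.sum_nonneg fun _ _ => abs_nonneg _)
    have hdet := eventually_abs_minimizer_sub_le (g := fun i => f (x i))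
      (z := fun i => fderiv ℝ (f (x i)) β)
      (fun i => ((hf_smooth i).differentiableAt (by norm_num)).hasFDerivAt) hβ
      (eq_zero_of_fderiv_eq_zero hS_rank) hS_ident hc hK (half_pos hε)
    filter_upwards [hcn, ENNReal.tendsto_nhds_zero.1 hb_mle _ hη3, hdet, eventually_gt_atTop 0]
      with n hn1 hn2 hn3 hn0
    have hn0' : (0 : ℝ) < n := by exact_mod_cast hn0
    have hn4 := (measure_exists_lt_abs_observedSum_le (hM n) (he_law n) (he_indep n) (hMe n)
      hR).trans hRη
    rw [← ENNReal.add_thirds η]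
    refine (measure_mono fun ω hω => ?_).trans ((measure_union_le _ _).trans
      (add_le_add ((measure_union_le _ _).trans (add_le_add hn1 hn2)) hn4))
    by_contra hcon
    simp only [Set.mem_union, Set.mem_ofPred_eq, not_or, not_not, not_exists, not_lt] at hcon
    obtain ⟨⟨hcount, hmle⟩, herr⟩ := hcon
    obtain ⟨s, hs, hsi⟩ := exists_normalEquations f x β Ψ hn0
      (isUnit_infoMatrix hS_rank fun i hi => (mul_pos hc hn0').trans_le (hcount i hi)) (e n ω)
    have h := hn3 (observedShare n (M n ω)) (dataVector Ψ n (M n ω) (e n ω))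
      (observedShare_nonneg n _) (observedShare_le_one _ (hcnt n))
      (fun i hi => (le_div_iff₀ hn0').2 (hcount i hi))
      (fun i => abs_dataVector_le hn0 (hcnt n) (herr i)) s hs (bhat n ω) hmle.1
      (fun θ hθ => hmle.wlsCriterion_le hn0 hv hθ) i
    rw [hsi] at h
    rw [Set.mem_ofPred_eq] at hω
    linarith
  -- transfer to the conditional laws
  rw [tendstoInMeasure_iff_dist]
  intro ε hε
  have hε2 : 0 < ε / 2 := half_pos hε
  have hδ : ENNReal.ofReal (ε / 2) ≠ 0 := (ENNReal.ofReal_pos.2 hε2).ne'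
  have hlim : Tendsto (fun n => P {ω | ¬ IsUnit (infoMatrix f x β (M n ω))}
      + P {ω | ε / 2 ≤ |√(n : ℝ) * (f (x i) (bhat n ω) - f (x i) β)
        - normalApprox f x β Ψ n (M n ω) (e n ω) i|} / ENNReal.ofReal (ε / 2))
      atTop (𝓝 0) := by
    have h := hunit.add (ENNReal.Tendsto.div_const (happrox _ hε2) (Or.inr hδ))
    simpa using h
  refine tendsto_of_tendsto_of_tendsto_of_le_of_le tendsto_const_nhds hlim
    (fun _ => zero_le) fun n => ?_
  set A : Set Ω := {ω | ε / 2 ≤ |√(n : ℝ) * (f (x i) (bhat n ω) - f (x i) β)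
        - normalApprox f x β Ψ n (M n ω) (e n ω) i|} with hA
  refine le_trans (measure_mono (t := {ω | P (M n ⁻¹' {M n ω}) = 0} ∪
    ({ω | ¬ IsUnit (infoMatrix f x β (M n ω))} ∪
      {ω | ENNReal.ofReal (ε / 2) < P[A | M n ⁻¹' {M n ω}]})) fun ω hω => ?_) ?_
  · by_contra hcon
    simp only [Set.mem_union, Set.mem_ofPred_eq, not_or, not_not, not_lt] at hcon
    obtain ⟨hpos, hu, hcond⟩ := hcon
    rw [Set.mem_ofPred_eq, Real.dist_eq, sub_zero,
      abs_of_nonneg (show 0 ≤ levyProkhorovDist _ _ from ENNReal.toReal_nonneg)] at hω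
    set m := M n ω
    have hms : MeasurableSet (M n ⁻¹' {m}) := hM n (measurableSet_singleton m)
    have := cond_isProbabilityMeasure hpos
    have hmeas := measurable_normalApprox f x β Ψ n m i
    have hL := hasLaw_cond_of_indepFun (hM n)
      (hasLaw_normalApprox f x β (he_law n) (he_indep n) Ψ n hu i)
      ((hMe n).comp measurable_id hmeas) hpos
    have hT : AEMeasurable (fun ω' => √(n : ℝ) * (f (x i) (bhat n ω') - f (x i) β))
        (P[|M n ⁻¹' {m}]) :=
      ((((hf_meas i).comp_aemeasurable (hb_meas n)).sub_const _).const_mul _).mono_ac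
        cond_absolutelyContinuous
    have hle : P[|M n ⁻¹' {m}] {ω' | ε / 2 ≤ |√(n : ℝ) * (f (x i) (bhat n ω') - f (x i) β)
        - normalApprox f x β Ψ n m (e n ω') i|} ≤ ENNReal.ofReal (ε / 2) := by
      refine le_trans (le_of_eq ?_) hcond
      rw [cond_apply hms, cond_apply hms]
      congr 2
      ext ω'
      refine and_congr_right fun h => ?_
      have h' : M n ω' = m := h
      simp only [hA, Set.mem_ofPred_eq, h']
    have hfin := levyProkhorovDist_map_le hT hL.aemeasurable hε2.le hle
    rw [hL.map_eq] at hfin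
    exact absurd (hω.trans hfin) (by linarith)
  · refine (measure_union_le _ _).trans ?_
    rw [measure_fiber_eq_zero (hM n), zero_add]
    refine (measure_union_le _ _).trans ?_
    gcongr
    exact measure_le_cond_fiber_le (hM n) A hδ ENNReal.ofReal_ne_top
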